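/- For $M\in\mathbb{C}^{n\times n}$ define $$\delta(M)=\Big(\|M\|_F^2-\tfrac1n|\operatorname{tr}(M)|^2\Big)^{1/2},$$ and let $s(M)$ be the largest $s$ such that, for some unitary $U$, $U^*MU=\operatorname{diag}(M_1,\dots,M_s)$ is block diagonal with $s$ (non-empty) square blocks $M_i$. **Theorem.** Let $A\in\mathbb{C}^{n\times n}$, and let $Q\in\mathbb{C}^{n\times n}$ be nonsingular with $Q^{-1}AQ=\operatorname{diag}(J_1,\dots,J_p)$, where each $J_i\in\mathbb{C}^{m_i\times m_i}$ is an (upper triangular) Jordan block, $m_i\ge 1$ and $\sum_{i=1}^p m_i=n$; put $m=\max_{1\le i\le p}m_i$. Let $\widetilde A=A+E$ with $E\in\mathbb{C}^{n\times n}$, and put $E_Q=Q^{-1}EQ$. Let $\lambda_1,\dots,\lambda_n$ and $\widetilde\lambda_1,\dots,\widetilde\lambda_n$ be the eigenvalues of $A$ and of $\widetilde A$, respectively, listed with algebraic multiplicity. Then there exists a permutation $\pi$ of $\{1,\dots,n\}$ such that $$\Big(\sum_{i=1}^n|\widetilde\lambda_{\pi(i)}-\lambda_i|^2\Big)^{1/2}\le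 \begin{cases} \sqrt{s_3\big(n-p+2\sqrt{n-p}\,\delta(E_Q)+1\big)\,\delta(E_Q)^{2/m}+\frac1n|\operatorname{tr}(E)|^2}, & \text{if }\delta(E_Q)<1,\\[4pt] \sqrt{s_2\big(\sqrt{n-p}+\delta(E_Q)\big)^2+\frac1n|\operatorname{tr}(E)|^2}, & \text{if }\delta(E_Q)\ge 1, \end{cases}$$ where $s_2=n+1-s(Q^{-1}\widetilde AQ)$ and $s_3=n+1-s(T^{-1}Q^{-1}\widetilde AQT)$, with $T=\operatorname{diag}(T_1,\dots,T_p)$, $T_i=\operatorname{diag}(1,\varepsilon,\dots,\varepsilon^{m_i-1})$ and $\varepsilon=\delta(E_Q)^{1/m}$. (If $\delta(E_Q)=0$, the term containing $s_3$ is read as $0$, also when $T$ is singular.) -/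

import Mathlib

open scoped Matrix

namespace SpecVar

noncomputable section

/-- The block diagonal matrix `diag(B₁, …, B_p)` of order `n = k₁ + ⋯ + k_p`, the block `Bᵢ` being
square of order `kᵢ`. The positions are listed block after block (lexicographic order). -/
def diagBlocks {n p : ℕ} (k : Fin p → ℕ) (h : ∑ i, k i = n)
    (B : ∀ i : Fin p, Matrix (Fin (k i)) (Fin (k i)) ℂ) : Matrix (Fin n) (Fin n) ℂ :=
  Matrix.reindex (finSigmaFinEquiv.trans (finCongr h)) (finSigmaFinEquiv.trans (finCongr h))
    (Matrix.blockDiagonal' B)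

/-- The upper triangular Jordan block of order `k` with eigenvalue `μ`. -/
def jordanBlock (k : ℕ) (μ : ℂ) : Matrix (Fin k) (Fin k) ℂ :=
  Matrix.of fun i j => if i = j then μ else if (i : ℕ) + 1 = (j : ℕ) then 1 else 0

/-- `T = diag(T₁, …, T_p)` with `Tᵢ = diag(1, ε, …, ε ^ (kᵢ - 1))`. -/
def scaling {n p : ℕ} (k : Fin p → ℕ) (h : ∑ i, k i = n) (ε : ℝ) : Matrix (Fin n) (Fin n) ℂ :=
  diagBlocks k h fun i => Matrix.diagonal fun j : Fin (k i) => (ε : ℂ) ^ (j : ℕ)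

section frobenius

attribute [local instance] Matrix.frobeniusNormedAddCommGroup

/-- `δ(M) = (‖M‖_F² - |tr M|² / n) ^ (1/2)`, with the Frobenius norm. -/
def delta {n : ℕ} (M : Matrix (Fin n) (Fin n) ℂ) : ℝ :=
  √(‖M‖ ^ 2 - 1 / (n : ℝ) * ‖M.trace‖ ^ 2)

end frobenius

/-- The numbers `s` such that some unitary similarity brings `M` to block diagonal form with `s`
(non-empty) square diagonal blocks. -/
def blockCounts {n : ℕ} (M : Matrix (Fin n) (Fin n) ℂ) : Set ℕ :=
  {s | ∃ U ∈ Matrix.unitaryGroup (Fin n) ℂ,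
    ∃ (k : Fin s → ℕ) (h : ∑ i, k i = n) (B : ∀ i : Fin s, Matrix (Fin (k i)) (Fin (k i)) ℂ),
      (∀ i, 0 < k i) ∧ Uᴴ * M * U = diagBlocks k h B}

/-- `s(M)`, the maximal number of diagonal blocks in a block diagonal form of `M` under unitary
similarity. -/
def maxBlocks {n : ℕ} (M : Matrix (Fin n) (Fin n) ℂ) : ℕ :=
  sSup (blockCounts M)

/-- The supremum defining `s(M)` is a maximum. -/
theorem isGreatest_maxBlocks {n : ℕ} (M : Matrix (Fin n) (Fin n) ℂ) :
    IsGreatest (blockCounts M) (maxBlocks M) := by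
  have hb : BddAbove (blockCounts M) := by
    refine ⟨n, ?_⟩
    rintro s ⟨U, -, k, h, B, hk, -⟩
    calc s = ∑ _i : Fin s, 1 := by simp
      _ ≤ ∑ i, k i := Finset.sum_le_sum fun i _ => hk i
      _ = n := h
  refine ⟨Nat.sSup_mem ?_ hb, fun s hs => le_csSup hb hs⟩
  rcases Nat.eq_zero_or_pos n with rfl | hn
  · exact ⟨0, 1, one_mem _, Fin.elim0, by simp, fun i => i.elim0, fun i => i.elim0,
      Subsingleton.elim _ _⟩
  · let e : (Σ _i : Fin 1, Fin n) ≃ Fin n :=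
      finSigmaFinEquiv.trans (finCongr (by simp : ∑ _i : Fin 1, n = n))
    refine ⟨1, 1, one_mem _, fun _ => n, by simp,
      fun i => Matrix.of fun a b => M (e ⟨i, a⟩) (e ⟨i, b⟩), fun _ => hn, ?_⟩
    ext a b
    obtain ⟨⟨i, x⟩, rfl⟩ := e.surjective a
    obtain ⟨⟨j, y⟩, rfl⟩ := e.surjective b
    obtain rfl : i = j := Subsingleton.elim _ _
    have h1 : ∀ z, (finSigmaFinEquiv.trans
        (finCongr (by simp : ∑ _i : Fin 1, n = n))).symm (e z) = z := e.symm_apply_apply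
    rw [diagBlocks, Matrix.reindex_apply, Matrix.submatrix_apply, h1, h1,
      Matrix.blockDiagonal'_apply_eq]
    simp

/-- `lam` lists the spectrum of `A`: all eigenvalues, with algebraic multiplicity. -/
def IsSpectrum {n : ℕ} (A : Matrix (Fin n) (Fin n) ℂ) (lam : Fin n → ℂ) : Prop :=
  (Finset.univ : Finset (Fin n)).val.map lam = A.charpoly.roots

/-- `𝔻₂ = (∑ᵢ |λ'_{π(i)} - λᵢ|²) ^ (1/2)`. -/
def dTwo {n : ℕ} (lam lam' : Fin n → ℂ) (π : Equiv.Perm (Fin n)) : ℝ :=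
  √(∑ i, ‖lam' (π i) - lam i‖ ^ 2)

end

end SpecVar

namespace SpecVar

/-! The Jordan form of `A` is a diagonal matrix `D` plus a nilpotent `N`, so `A + E` is similar to a
perturbation of the normal matrix `D`. The argument compares its spectrum with that of `D`.

Let `M` be any matrix, `W` a unitary that brings it to `s = maxBlocks M` triangular diagonal blocks
`R`, and `X = Wᴴ * D * W`. Hoffman–Wielandt bounds the eigenvalue distance by the Frobenius distance
from the diagonal of `R` to `X` (`exists_perm_sum_normSq_le`). Replacing `R` by its diagonal exposes
the entries of `X` above the diagonal. Normality of `X` trades these, one cut of the index set at a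
time, for entries where `R` vanishes (`frobSq_diagonal_sub_normal_le`). One cut is needed for each
index that is not first in its block, which gives the factor `1 + (n - s)`.

Shifting `D` by the mean of the trace replaces the norm by `delta` and splits off the trace term
(`exists_perm_sum_le_delta`). Finally, conjugation by the scaling matrix multiplies `N` by `ε` and
enlarges entries of `E_Q` by at most `ε ^ (-(m - 1))`. The choice `ε ^ m = δ` balances the two
effects when `δ < 1`; otherwise `ε = 1` is used. -/

/-- The square of the Frobenius norm. -/
noncomputable def frobSq {ι : Type*} [Fintype ι] (M : Matrix ι ι ℂ) : ℝ :=
  ∑ i, ∑ j, ‖M i j‖ ^ 2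

/-! ### Frobenius norm, Hoffman–Wielandt, and cuts of normal matrices -/

section general

variable {ι : Type*} [Fintype ι]

theorem frobSq_nonneg (M : Matrix ι ι ℂ) : 0 ≤ frobSq M :=
  Finset.sum_nonneg fun _ _ => Finset.sum_nonneg fun _ _ => sq_nonneg _

theorem conjTranspose_mul_self_apply_self (M : Matrix ι ι ℂ) (i : ι) :
    (Mᴴ * M) i i = ((∑ j, ‖M j i‖ ^ 2 : ℝ) : ℂ) := by
  simp [Matrix.mul_apply, Complex.conj_mul']

theorem mul_conjTranspose_self_apply_self (M : Matrix ι ι ℂ) (i : ι) :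
    (M * Mᴴ) i i = ((∑ j, ‖M i j‖ ^ 2 : ℝ) : ℂ) := by
  simp [Matrix.mul_apply, Complex.mul_conj']

theorem trace_conjTranspose_mul_self (M : Matrix ι ι ℂ) :
    (Mᴴ * M).trace = (frobSq M : ℂ) := by
  simp only [Matrix.trace, Matrix.diag_apply, conjTranspose_mul_self_apply_self]
  rw [← Complex.ofReal_sum, Finset.sum_comm, frobSq]

theorem frobSq_unitary_mul [DecidableEq ι] {U : Matrix ι ι ℂ} (hU : U ∈ Matrix.unitaryGroup ι ℂ)
    (M : Matrix ι ι ℂ) : frobSq (U * M) = frobSq M := by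
  have h : Uᴴ * U = 1 := Matrix.mem_unitaryGroup_iff'.1 hU
  have : (frobSq (U * M) : ℂ) = frobSq M := by
    rw [← trace_conjTranspose_mul_self, ← trace_conjTranspose_mul_self,
      Matrix.conjTranspose_mul, Matrix.mul_assoc, ← Matrix.mul_assoc Uᴴ, h, Matrix.one_mul]
  exact_mod_cast this

theorem frobSq_mul_unitary [DecidableEq ι] {U : Matrix ι ι ℂ} (hU : U ∈ Matrix.unitaryGroup ι ℂ)
    (M : Matrix ι ι ℂ) : frobSq (M * U) = frobSq M := by
  have h : U * Uᴴ = 1 := Matrix.mem_unitaryGroup_iff.1 hU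
  have : (frobSq (M * U) : ℂ) = frobSq M := by
    rw [← trace_conjTranspose_mul_self, ← trace_conjTranspose_mul_self,
      Matrix.conjTranspose_mul, Matrix.mul_assoc, Matrix.trace_mul_comm, Matrix.mul_assoc,
      Matrix.mul_assoc, h, Matrix.mul_one]
  exact_mod_cast this

theorem normSq_mem_doublyStochastic [DecidableEq ι] {U : Matrix ι ι ℂ} (hU : U ∈ Matrix.unitaryGroup ι ℂ) :
    (Matrix.of fun i j => ‖U i j‖ ^ 2) ∈ doublyStochastic ℝ ι := by
  refine mem_doublyStochastic_iff_sum.2 ⟨fun i j => sq_nonneg _, fun i => ?_, fun i => ?_⟩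
  · have h := mul_conjTranspose_self_apply_self U i
    rw [show U * Uᴴ = 1 from Matrix.mem_unitaryGroup_iff.1 hU, Matrix.one_apply_eq] at h
    exact_mod_cast h.symm
  · have h := conjTranspose_mul_self_apply_self U i
    rw [show Uᴴ * U = 1 from Matrix.mem_unitaryGroup_iff'.1 hU, Matrix.one_apply_eq] at h
    exact_mod_cast h.symm

/-- A linear functional on the doubly stochastic matrices dominates its value at some
permutation matrix. -/
theorem exists_perm_sum_le [DecidableEq ι] {P : Matrix ι ι ℝ} (hP : P ∈ doublyStochastic ℝ ι) (c : ι → ι → ℝ) :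
    ∃ σ : Equiv.Perm ι, ∑ i, c i (σ i) ≤ ∑ i, ∑ j, P i j * c i j := by
  -- By Birkhoff's theorem the right-hand side is a weighted average of the permutation values, and
  -- some value is at most the average.
  obtain ⟨w, hw0, hw1, rfl⟩ := exists_eq_sum_perm_of_mem_doublyStochastic hP
  have key : ∑ i, ∑ j, (∑ σ : Equiv.Perm ι, w σ • σ.permMatrix ℝ) i j * c i j
      = ∑ σ : Equiv.Perm ι, w σ * ∑ i, c i (σ i) := by
    simp only [Matrix.sum_apply, Finset.sum_mul, Finset.mul_sum]
    simp_rw [Finset.sum_comm (s := Finset.univ (α := ι)) (t := Finset.univ (α := Equiv.Perm ι))]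
    refine Finset.sum_congr rfl fun σ _ => Finset.sum_congr rfl fun i _ => ?_
    simp [PEquiv.toMatrix_apply, Equiv.toPEquiv_apply]
  rw [key]
  by_contra! h
  have hlt : ∑ σ : Equiv.Perm ι,
      w σ * (∑ τ : Equiv.Perm ι, w τ * ∑ i, c i (τ i)) < ∑ σ, w σ * ∑ i, c i (σ i) := by
    refine Finset.sum_lt_sum (fun σ _ => mul_le_mul_of_nonneg_left (h σ).le (hw0 σ)) ?_
    by_contra! h'
    have : ∀ σ ∈ Finset.univ, w σ = 0 := fun σ hσ => by
      by_contra hne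
      exact absurd (h' σ hσ)
        (not_le.2 (mul_lt_mul_of_pos_left (h σ) ((hw0 σ).lt_of_ne (Ne.symm hne))))
    simp [Finset.sum_eq_zero this] at hw1
  rw [← Finset.sum_mul, hw1, one_mul] at hlt
  exact lt_irrefl _ hlt

/-- The **Hoffman–Wielandt** inequality. -/
theorem exists_perm_sum_normSq_le [DecidableEq ι] {U : Matrix ι ι ℂ} (hU : U ∈ Matrix.unitaryGroup ι ℂ)
    (d e : ι → ℂ) : ∃ σ : Equiv.Perm ι, ∑ i, ‖e (σ i) - d i‖ ^ 2 ≤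
      frobSq (Matrix.diagonal e - Uᴴ * Matrix.diagonal d * U) := by
  obtain ⟨σ, hσ⟩ := exists_perm_sum_le (normSq_mem_doublyStochastic hU)
    fun i j => ‖e j - d i‖ ^ 2
  refine ⟨σ, hσ.trans_eq ?_⟩
  -- After left multiplication by `U` the `(i, j)` entry is `U i j * (e j - d i)`, so the norm is
  -- the doubly stochastic sum in `hσ`.
  have h : U * Uᴴ = 1 := Matrix.mem_unitaryGroup_iff.1 hU
  rw [← frobSq_unitary_mul hU, Matrix.mul_sub, Matrix.mul_assoc Uᴴ, ← Matrix.mul_assoc U Uᴴ, h,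
    Matrix.one_mul, frobSq]
  refine Finset.sum_congr rfl fun i _ => Finset.sum_congr rfl fun j _ => ?_
  rw [Matrix.sub_apply, Matrix.mul_diagonal, Matrix.diagonal_mul, Matrix.of_apply, mul_comm (d i),
    ← mul_sub, norm_mul, mul_pow]

/-- In a normal matrix, the two off-diagonal blocks cut out by a set of indices have the same
Frobenius norm. -/
theorem sum_cut_eq_of_normal {X : Matrix ι ι ℂ} (hX : X * Xᴴ = Xᴴ * X) (S : Set ι)
    [DecidablePred (· ∈ S)] :
    ∑ i, ∑ j, (if i ∈ S ∧ j ∉ S then ‖X i j‖ ^ 2 else 0)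
      = ∑ i, ∑ j, (if i ∈ S ∧ j ∉ S then ‖X j i‖ ^ 2 else 0) := by
  -- Row `i` and column `i` of a normal matrix have equal norms. Summing over `i ∈ S`, the part
  -- inside `S × S` is common to both sides and cancels.
  have hrow : ∀ i, ∑ j, ‖X i j‖ ^ 2 = ∑ j, ‖X j i‖ ^ 2 := fun i => by
    have h := mul_conjTranspose_self_apply_self X i
    rw [hX, conjTranspose_mul_self_apply_self] at h
    exact_mod_cast h.symm
  have hsplit : ∀ g : ι → ι → ℝ, ∑ i, ∑ j, (if i ∈ S ∧ j ∉ S then g i j else 0)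
      = ∑ i, (if i ∈ S then ∑ j, g i j else 0)
        - ∑ i, ∑ j, (if i ∈ S ∧ j ∈ S then g i j else 0) := fun g => by
    rw [← Finset.sum_sub_distrib]
    refine Finset.sum_congr rfl fun i _ => ?_
    by_cases hi : i ∈ S
    · simp only [hi, true_and, if_true]
      rw [← Finset.sum_sub_distrib]
      refine Finset.sum_congr rfl fun j _ => ?_
      by_cases hj : j ∈ S <;> simp [hj]
    · simp [hi]
  rw [hsplit fun i j => ‖X i j‖ ^ 2, hsplit fun i j => ‖X j i‖ ^ 2]
  simp only [hrow]
  congr 1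
  rw [Finset.sum_comm]
  simp only [and_comm]

/-- If `R` is triangular with respect to a strict partial order `r` and `X` is normal, then the
distance from the diagonal of `R` to `X` is controlled by the distance from `R` to `X`. -/
theorem frobSq_diagonal_sub_normal_le [DecidableEq ι] {X R : Matrix ι ι ℂ} (hX : X * Xᴴ = Xᴴ * X)
    (r : ι → ι → Prop) [DecidableRel r] (hirr : ∀ i, ¬ r i i)
    (htrans : ∀ i j l, r i j → r j l → r i l) (hR : ∀ i j, i ≠ j → ¬ r i j → R i j = 0) :
    frobSq (Matrix.diagonal (fun i => R i i) - X) ≤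
      (1 + (Finset.univ.filter fun c => ∃ i, r i c).card) * frobSq (R - X) := by
  set C := Finset.univ.filter fun c => ∃ i, r i c with hC
  set a := ∑ i, ∑ j, (if r i j then 0 else ‖(R - X) i j‖ ^ 2) with ha
  have ha_le : a ≤ frobSq (R - X) := by
    refine Finset.sum_le_sum fun i _ => Finset.sum_le_sum fun j _ => ?_
    split_ifs
    · positivity
    · exact le_rfl
  have h1 : frobSq (Matrix.diagonal (fun i => R i i) - X)
      = a + ∑ i, ∑ j, (if r i j then ‖X i j‖ ^ 2 else 0) := by
    rw [ha, frobSq, ← Finset.sum_add_distrib]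
    refine Finset.sum_congr rfl fun i _ => ?_
    rw [← Finset.sum_add_distrib]
    refine Finset.sum_congr rfl fun j _ => ?_
    by_cases hij : i = j
    · subst hij
      simp [hirr i]
    · by_cases hr : r i j
      · simp [hr, Matrix.diagonal_apply_ne _ hij]
      · simp [hr, Matrix.diagonal_apply_ne _ hij, hR i j hij hr]
  -- An entry with `r i j` crosses the cut of the strict lower set of `j`, so the cuts indexed by
  -- `C` cover all these entries.
  have h2 : ∑ i, ∑ j, (if r i j then ‖X i j‖ ^ 2 else 0)
      ≤ ∑ c ∈ C, ∑ i, ∑ j, (if i ∈ {x | r x c} ∧ j ∉ {x | r x c} then ‖X i j‖ ^ 2 else 0) := by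
    have hcomm : ∀ f : ι → ι → ι → ℝ,
        ∑ c ∈ C, ∑ i, ∑ j, f c i j = ∑ i, ∑ j, ∑ c ∈ C, f c i j := fun f => by
      rw [Finset.sum_comm]
      exact Finset.sum_congr rfl fun i _ => Finset.sum_comm
    rw [hcomm]
    refine Finset.sum_le_sum fun i _ => Finset.sum_le_sum fun j _ => ?_
    split_ifs with hr
    · have hj : j ∈ C := by simpa [hC] using ⟨i, hr⟩
      refine le_trans ?_ (Finset.single_le_sum
        (f := fun c => if i ∈ {x | r x c} ∧ j ∉ {x | r x c} then ‖X i j‖ ^ 2 else 0)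
        (fun c _ => ?_) hj)
      · simp [hr, hirr j]
      · split_ifs <;> positivity
    · exact Finset.sum_nonneg fun c _ => by split_ifs <;> positivity
  have h3 : ∀ c ∈ C,
      ∑ i, ∑ j, (if i ∈ {x | r x c} ∧ j ∉ {x | r x c} then ‖X i j‖ ^ 2 else 0) ≤ a := by
    intro c _
    rw [sum_cut_eq_of_normal hX, ha, Finset.sum_comm]
    refine Finset.sum_le_sum fun j _ => Finset.sum_le_sum fun i _ => ?_
    by_cases hcut : i ∈ {x | r x c} ∧ j ∉ {x | r x c}
    · have hji : ¬ r j i := fun h => hcut.2 (htrans _ _ _ h hcut.1)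
      have hne : j ≠ i := fun h => hcut.2 (h ▸ hcut.1)
      rw [if_pos hcut, if_neg hji, Matrix.sub_apply, hR j i hne hji, zero_sub, norm_neg]
    · rw [if_neg hcut]
      split_ifs <;> positivity
  have h4 := Finset.sum_le_card_nsmul _ _ _ h3
  rw [nsmul_eq_mul] at h4
  calc _ ≤ a + C.card * a := by rw [h1]; gcongr; exact h2.trans h4
    _ = (1 + C.card) * a := by ring
    _ ≤ _ := by gcongr

end general

/-! ### Eigenvalue lists and unitary triangularization -/

/-- Two families with the same multiset of values differ by a permutation. -/
theorem exists_perm_comp_eq_of_map_eq {ι β : Type*} [Fintype ι] {f g : ι → β}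
    (h : (Finset.univ : Finset ι).val.map f = (Finset.univ : Finset ι).val.map g) :
    ∃ σ : Equiv.Perm ι, f = g ∘ σ := by
  classical
  have hc : ∀ b, Nonempty ({i // f i = b} ≃ {i // g i = b}) := fun b => by
    have := congrArg (Multiset.count b) h
    rw [Multiset.count_map, Multiset.count_map] at this
    refine Fintype.card_eq.1 ?_
    rw [Fintype.card_subtype, Fintype.card_subtype]
    simpa [Finset.card_def, eq_comm] using this
  exact ⟨Equiv.ofFiberEquiv fun b => (hc b).some,
    funext fun i => (Equiv.ofFiberEquiv_map (fun b => (hc b).some) i).symm⟩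

theorem orthonormalBasis_matrix_mem_unitaryGroup {n : ℕ}
    (b : OrthonormalBasis (Fin n) ℂ (EuclideanSpace ℂ (Fin n))) :
    (Matrix.of fun i j => b j i) ∈ Matrix.unitaryGroup (Fin n) ℂ := by
  rw [Matrix.mem_unitaryGroup_iff']
  ext i j
  have := orthonormal_iff_ite.1 b.orthonormal i j
  rw [PiLp.inner_apply] at this
  simpa [Matrix.mul_apply, Matrix.one_apply, mul_comm] using this

/-- Every complex square matrix maps the first column of some unitary matrix to a multiple of
itself. -/
theorem exists_unitary_conj_col_zero {n : ℕ} (M : Matrix (Fin (n + 1)) (Fin (n + 1)) ℂ) :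
    ∃ U ∈ Matrix.unitaryGroup (Fin (n + 1)) ℂ, ∀ i, i ≠ 0 → (Uᴴ * M * U) i 0 = 0 := by
  obtain ⟨c, hc⟩ := Module.End.exists_eigenvalue (Matrix.toLin' M)
  obtain ⟨v, hv⟩ := hc.exists_hasEigenvector
  have hv1 : M *ᵥ v = c • v := by simpa using hv.apply_eq_smul
  set w : EuclideanSpace ℂ (Fin (n + 1)) := WithLp.toLp 2 v with hw
  have hw0 : w ≠ 0 := fun h => hv.2 (by simpa [hw] using h)
  -- Only the basis vector of index `0` is prescribed: a normalized eigenvector. The others come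
  -- from an orthonormal extension.
  have hon : Orthonormal ℂ (({0} : Set (Fin (n + 1))).domRestrict
      fun _ => ((‖w‖⁻¹ : ℝ) : ℂ) • w) := by
    refine ⟨fun _ => ?_, fun i j hij => absurd (Subsingleton.elim i j) hij⟩
    have hn : ‖w‖ ≠ 0 := norm_ne_zero_iff.2 hw0
    simp [norm_smul, hn]
  obtain ⟨b, hb⟩ := hon.exists_orthonormalBasis_extension_of_card_eq (by simp)
  have hb0 : b 0 = ((‖w‖⁻¹ : ℝ) : ℂ) • w := hb 0 rfl
  refine ⟨_, orthonormalBasis_matrix_mem_unitaryGroup b, fun i hi => ?_⟩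
  set U : Matrix (Fin (n + 1)) (Fin (n + 1)) ℂ := Matrix.of fun i j => b j i with hU
  have hUU : Uᴴ * U = 1 :=
    Matrix.mem_unitaryGroup_iff'.1 (orthonormalBasis_matrix_mem_unitaryGroup b)
  have hcol : ∀ l, (M * U) l 0 = c * U l 0 := fun l => by
    have h := congrFun hv1 l
    simp only [Matrix.mulVec, dotProduct, Pi.smul_apply, smul_eq_mul] at h
    simp only [Matrix.mul_apply, hU, Matrix.of_apply, hb0, PiLp.smul_apply, smul_eq_mul, hw]
    rw [mul_left_comm c, ← h, Finset.mul_sum]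
    exact Finset.sum_congr rfl fun j _ => by ring
  have h10 := congrFun (congrFun hUU i) 0
  rw [Matrix.one_apply_ne hi, Matrix.mul_apply] at h10
  rw [Matrix.mul_assoc, Matrix.mul_apply]
  simp only [hcol, mul_left_comm _ c]
  rw [← Finset.mul_sum, h10, mul_zero]

/-- **Schur triangularization**. -/
theorem exists_unitary_conj_upperTriangular : ∀ {n : ℕ} (M : Matrix (Fin n) (Fin n) ℂ),
    ∃ U ∈ Matrix.unitaryGroup (Fin n) ℂ, ∀ i j, j < i → (Uᴴ * M * U) i j = 0
  | 0, _ => ⟨1, one_mem _, fun i => i.elim0⟩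
  | n + 1, M => by
    obtain ⟨W, hW, hW0⟩ := exists_unitary_conj_col_zero M
    set N := Wᴴ * M * W with hN
    obtain ⟨V, hV, hVt⟩ := exists_unitary_conj_upperTriangular (N.submatrix Fin.succ Fin.succ)
    -- `V' = diag(1, V)` keeps the first column already cleared by `W`.
    let V' : Matrix (Fin (n + 1)) (Fin (n + 1)) ℂ :=
      Matrix.of fun i j => Fin.cases (Fin.cases 1 (fun _ => 0) j)
        (fun i' => Fin.cases 0 (fun j' => V i' j') j) i
    have h00 : V' 0 0 = 1 := rfl
    have h0s : ∀ j, V' 0 (Fin.succ j) = 0 := fun _ => rfl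
    have hs0 : ∀ i, V' (Fin.succ i) 0 = 0 := fun _ => rfl
    have hss : ∀ i j, V' (Fin.succ i) (Fin.succ j) = V i j := fun _ _ => rfl
    have hVV : Vᴴ * V = 1 := Matrix.mem_unitaryGroup_iff'.1 hV
    have hV' : V' ∈ Matrix.unitaryGroup (Fin (n + 1)) ℂ := by
      rw [Matrix.mem_unitaryGroup_iff', Matrix.star_eq_conjTranspose]
      ext i j
      refine Fin.cases ?_ (fun i' => ?_) i <;> refine Fin.cases ?_ (fun j' => ?_) j
      · simp [Matrix.mul_apply, Fin.sum_univ_succ, h00, hs0]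
      · simp [Matrix.mul_apply, Fin.sum_univ_succ, h00, hs0, h0s, eq_comm]
      · simp [Matrix.mul_apply, Fin.sum_univ_succ, h00, hs0, h0s]
      · have h := congrFun (congrFun hVV i') j'
        simp only [Matrix.mul_apply, Matrix.conjTranspose_apply, Matrix.one_apply] at h
        simpa [Matrix.mul_apply, Fin.sum_univ_succ, h0s, hss, Matrix.one_apply] using h
    refine ⟨W * V', mul_mem hW hV', fun i j hij => ?_⟩
    have hconj : (W * V')ᴴ * M * (W * V') = V'ᴴ * N * V' := by
      rw [hN, Matrix.conjTranspose_mul]; simp only [Matrix.mul_assoc]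
    rw [hconj]
    obtain ⟨i, rfl⟩ := Fin.exists_succ_eq.2 (Fin.ne_of_gt (lt_of_le_of_lt (Fin.zero_le j) hij))
    refine Fin.cases (fun _ => ?_) (fun j hij => ?_) j hij
    · simp [Matrix.mul_apply, Fin.sum_univ_succ, h0s, hs0, h00,
        hW0 _ (Fin.succ_ne_zero _)]
    · have h := hVt i j (Fin.succ_lt_succ_iff.1 hij)
      simp only [Matrix.mul_apply, Matrix.conjTranspose_apply, Matrix.submatrix_apply] at h
      simpa [Matrix.mul_apply, Fin.sum_univ_succ, h0s, hss] using h

/-- A linear extension of the order reduces this to ordinary triangular matrices. The partial order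
on `Σ a, Fin (k a)`, which compares only indices of the same block, lets one condition express both
block diagonality and triangularity of the blocks. -/
theorem charpoly_of_partialOrder_triangular {ι : Type*} [Fintype ι] [DecidableEq ι]
    [PartialOrder ι] (M : Matrix ι ι ℂ) (h : ∀ i j, ¬ i ≤ j → M i j = 0) :
    M.charpoly = ∏ i, (Polynomial.X - Polynomial.C (M i i)) := by
  let l : LinearOrder ι := LinearOrder.lift' (toLinearExtension : ι →o LinearExtension ι)
    (fun _ _ hxy => hxy)
  refine @Matrix.charpoly_of_isUpperTriangular ℂ _ ι _ _ l M fun i j hij => h i j fun hle => ?_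
  exact absurd ((toLinearExtension : ι →o LinearExtension ι).monotone hle)
    (not_le_of_gt (α := LinearExtension ι) hij)

theorem roots_prod_X_sub_C_univ {ι : Type*} [Fintype ι] (f : ι → ℂ) :
    (∏ i, (Polynomial.X - Polynomial.C (f i))).roots = Finset.univ.val.map f :=
  Polynomial.roots_multiset_prod_X_sub_C (Finset.univ.val.map f) ▸ by
    rw [Multiset.map_map]; rfl

theorem charpoly_conj_of_mul_eq_one {ι : Type*} [Fintype ι] [DecidableEq ι]
    {P R : Matrix ι ι ℂ} (h : R * P = 1) (M : Matrix ι ι ℂ) :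
    (P * M * R).charpoly = M.charpoly := by
  rw [Matrix.charpoly_mul_comm, ← Matrix.mul_assoc, h, Matrix.one_mul]

/-- Unitary block diagonalization, refined to triangular diagonal blocks. -/
theorem exists_unitary_conj_blockTriangular {n : ℕ} (M : Matrix (Fin n) (Fin n) ℂ) :
    ∃ W ∈ Matrix.unitaryGroup (Fin n) ℂ, ∃ (k : Fin (maxBlocks M) → ℕ)
      (eq : (Σ a, Fin (k a)) ≃ Fin n), (∀ a, 0 < k a) ∧
      ∀ x y, ¬ x ≤ y → (Wᴴ * M * W) (eq x) (eq y) = 0 := by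
  obtain ⟨U, hU, k, h, B, hk, hB⟩ := (isGreatest_maxBlocks M).1
  choose V hV hVt using fun a => exists_unitary_conj_upperTriangular (B a)
  set eq := finSigmaFinEquiv.trans (finCongr h) with heq
  set V' := Matrix.reindex eq eq (Matrix.blockDiagonal' V) with hV'
  have hVH : V'ᴴ = Matrix.reindex eq eq (Matrix.blockDiagonal' fun a => (V a)ᴴ) := by
    rw [hV', Matrix.conjTranspose_reindex, Matrix.blockDiagonal'_conjTranspose]
  have hVmem : V' ∈ Matrix.unitaryGroup (Fin n) ℂ := by
    rw [Matrix.mem_unitaryGroup_iff', Matrix.star_eq_conjTranspose, hVH, hV']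
    simp only [Matrix.reindex_apply, Matrix.submatrix_mul_equiv, ← Matrix.blockDiagonal'_mul]
    have : (fun a => (V a)ᴴ * V a) = 1 := funext fun a => Matrix.mem_unitaryGroup_iff'.1 (hV a)
    rw [this, Matrix.blockDiagonal'_one, Matrix.submatrix_one_equiv]
  refine ⟨U * V', mul_mem hU hVmem, k, eq, hk, ?_⟩
  have hconj : (U * V')ᴴ * M * (U * V')
      = Matrix.reindex eq eq (Matrix.blockDiagonal' fun a => (V a)ᴴ * B a * V a) := by
    have h1 : (U * V')ᴴ * M * (U * V') = V'ᴴ * (Uᴴ * M * U) * V' := by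
      rw [Matrix.conjTranspose_mul]; simp only [Matrix.mul_assoc]
    rw [h1, hB, diagBlocks, ← heq, hVH, hV']
    simp only [Matrix.reindex_apply, Matrix.submatrix_mul_equiv, ← Matrix.blockDiagonal'_mul]
  rintro ⟨a, i⟩ ⟨b, j⟩ hxy
  rw [hconj, Matrix.reindex_apply, Matrix.submatrix_apply, Equiv.symm_apply_apply,
    Equiv.symm_apply_apply]
  by_cases hab : a = b
  · subst hab
    rw [Matrix.blockDiagonal'_apply_eq]
    exact hVt a i j (not_le.1 fun hle => hxy (Sigma.mk_le_mk_iff.2 hle))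
  · exact Matrix.blockDiagonal'_apply_ne _ _ _ hab

/-- The first index of each of the `s` nonempty blocks is minimal, hence fails `P`. This bounds the
number of cuts. -/
theorem card_not_minimal_le {n s : ℕ} (k : Fin s → ℕ) (hk : ∀ a, 0 < k a)
    (eq : (Σ a, Fin (k a)) ≃ Fin n) (P : Fin n → Prop) [DecidablePred P]
    (hP : ∀ c, P c → ∃ x, x < eq.symm c) :
    ((Finset.univ.filter P).card : ℝ) ≤ n - s := by
  have h1 := Finset.card_filter_add_card_filter_not (s := (Finset.univ : Finset (Fin n))) P
  have h2 : s ≤ (Finset.univ.filter fun c => ¬ P c).card := by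
    have hinj : Function.Injective fun a : Fin s => eq ⟨a, ⟨0, hk a⟩⟩ := fun a b hab =>
      congrArg Sigma.fst (eq.injective hab)
    calc s = (Finset.univ.map ⟨_, hinj⟩).card := by simp
      _ ≤ _ := Finset.card_le_card fun c hc => by
        obtain ⟨a, -, rfl⟩ := Finset.mem_map.1 hc
        refine Finset.mem_filter.2 ⟨Finset.mem_univ _, fun hp => ?_⟩
        obtain ⟨x, hx⟩ := hP _ hp
        simp only [Function.Embedding.coeFn_mk, Equiv.symm_apply_apply] at hx
        obtain ⟨_, _, b, hb⟩ := hx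
        exact absurd hb (Nat.not_lt_zero _)
  rw [Finset.card_univ, Fintype.card_fin] at h1
  rw [le_sub_iff_add_le]
  exact_mod_cast (by omega : (Finset.univ.filter P).card + s ≤ n)

/-! ### Spectral variation of a diagonal matrix, with the trace split off -/

/-- Spectral variation of a diagonal matrix under an arbitrary perturbation. -/
theorem exists_perm_sum_le_frobSq {n : ℕ} (d e : Fin n → ℂ) (M : Matrix (Fin n) (Fin n) ℂ)
    (he : IsSpectrum M e) : ∃ σ : Equiv.Perm (Fin n), ∑ i, ‖e (σ i) - d i‖ ^ 2 ≤
      ((n : ℝ) + 1 - maxBlocks M) * frobSq (M - Matrix.diagonal d) := by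
  classical
  obtain ⟨W, hW, k, eq, hk, hR⟩ := exists_unitary_conj_blockTriangular M
  have hWW : W * Wᴴ = 1 := Matrix.mem_unitaryGroup_iff.1 hW
  set R := Wᴴ * M * W with hRdef
  set X := Wᴴ * Matrix.diagonal d * W with hX
  have hspec : Finset.univ.val.map e = Finset.univ.val.map fun i => R i i := by
    rw [he, ← charpoly_conj_of_mul_eq_one hWW M, ← hRdef, ← Matrix.charpoly_reindex eq.symm,
      charpoly_of_partialOrder_triangular _ fun x y hxy => by simpa using hR x y hxy,
      ← roots_prod_X_sub_C_univ]
    refine congrArg Polynomial.roots (Fintype.prod_equiv eq _ _ fun x => ?_)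
    simp
  obtain ⟨τ, hτ⟩ := exists_perm_comp_eq_of_map_eq hspec.symm
  obtain ⟨σ, hσ⟩ := exists_perm_sum_normSq_le hW d fun i => R i i
  refine ⟨σ.trans τ, ?_⟩
  have hnormal : X * Xᴴ = Xᴴ * X := by
    have hXH : Xᴴ = Wᴴ * (Matrix.diagonal d)ᴴ * W := by
      rw [hX]; simp only [Matrix.conjTranspose_mul, Matrix.conjTranspose_conjTranspose,
        Matrix.mul_assoc]
    have hprod : ∀ P S : Matrix (Fin n) (Fin n) ℂ,
        Wᴴ * P * W * (Wᴴ * S * W) = Wᴴ * (P * S) * W := fun P S => by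
      calc _ = Wᴴ * P * (W * Wᴴ) * S * W := by simp only [Matrix.mul_assoc]
        _ = _ := by rw [hWW]; simp only [Matrix.mul_assoc, Matrix.mul_one]
    rw [hXH, hX, hprod, hprod, Matrix.diagonal_conjTranspose, Matrix.diagonal_mul_diagonal,
      Matrix.diagonal_mul_diagonal]
    simp only [mul_comm]
  have hcut := frobSq_diagonal_sub_normal_le (R := R) hnormal
    (fun a b => eq.symm a < eq.symm b) (fun i => lt_irrefl _) (fun i j l => lt_trans)
    (fun i j hij hlt => by
      have := hR (eq.symm i) (eq.symm j)
        fun hle => hlt (lt_of_le_of_ne hle fun h => hij (eq.symm.injective h))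
      simpa using this)
  have hcard := card_not_minimal_le k hk eq (fun c => ∃ i, eq.symm i < eq.symm c)
    fun c ⟨i, hi⟩ => ⟨_, hi⟩
  have hRX : frobSq (R - X) = frobSq (M - Matrix.diagonal d) := by
    rw [hRdef, hX, ← Matrix.sub_mul, ← Matrix.mul_sub, frobSq_mul_unitary hW,
      frobSq_unitary_mul (U := Wᴴ) (Unitary.star_mem hW)]
  rw [hRX] at hcut
  have hfun : ∀ i, e (τ i) = R i i := fun i => (congrFun hτ i).symm
  simp only [Equiv.trans_apply, hfun]
  refine hσ.trans (hcut.trans ?_)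
  refine mul_le_mul_of_nonneg_right ?_ (frobSq_nonneg _)
  have hcard' := (add_le_add_right hcard 1).trans_eq
    (by ring : (1 : ℝ) + (n - maxBlocks M) = n + 1 - maxBlocks M)
  refine le_trans (le_of_eq ?_) hcard'
  congr!

theorem sum_norm_sub_mean_sq {n : ℕ} (y : Fin n → ℂ) :
    ∑ i, ‖y i - (∑ j, y j) / n‖ ^ 2 = ∑ i, ‖y i‖ ^ 2 - 1 / (n : ℝ) * ‖∑ j, y j‖ ^ 2 := by
  rcases Nat.eq_zero_or_pos n with rfl | hn
  · simp
  have hn' : (n : ℝ) ≠ 0 := by positivity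
  set S := ∑ j, y j with hS
  simp only [← Complex.normSq_eq_norm_sq, Complex.normSq_sub, Finset.sum_sub_distrib,
    Finset.sum_add_distrib, ← Finset.mul_sum, ← Complex.re_sum, ← Finset.sum_mul]
  rw [← hS]
  simp only [map_div₀, Complex.conj_natCast, ← mul_div_assoc, Complex.mul_conj,
    Complex.normSq_natCast, Finset.sum_const, Finset.card_univ, Fintype.card_fin, nsmul_eq_mul,
    Complex.div_natCast_re, Complex.ofReal_re]
  field_simp
  ring

theorem frobSq_sub_scalar {n : ℕ} (M : Matrix (Fin n) (Fin n) ℂ) :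
    frobSq (M - (M.trace / n) • 1) = frobSq M - 1 / (n : ℝ) * ‖M.trace‖ ^ 2 := by
  have h := sum_norm_sub_mean_sq fun i => M i i
  have htr : ∑ i, M i i = M.trace := rfl
  rw [htr] at h
  have h2 : frobSq (M - (M.trace / n) • 1) - frobSq M
      = ∑ i, ‖M i i - M.trace / n‖ ^ 2 - ∑ i, ‖M i i‖ ^ 2 := by
    rw [frobSq, frobSq, ← Finset.sum_sub_distrib, ← Finset.sum_sub_distrib]
    refine Finset.sum_congr rfl fun i _ => ?_
    rw [← Finset.sum_sub_distrib, Finset.sum_eq_single i]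
    · simp
    · intro j _ hj
      simp [Matrix.one_apply_ne hj.symm]
    · simp
  linarith

attribute [local instance] Matrix.frobeniusNormedAddCommGroup in
theorem frobenius_norm_sq {n : ℕ} (M : Matrix (Fin n) (Fin n) ℂ) : ‖M‖ ^ 2 = frobSq M := by
  rw [Matrix.frobenius_norm_def, ← Real.sqrt_eq_rpow, Real.sq_sqrt
    (Finset.sum_nonneg fun _ _ => Finset.sum_nonneg fun _ _ => by positivity)]
  simp [frobSq]

/-- Subtracting the mean of the diagonal is a variance identity. In particular the radicand in
`delta` is nonnegative, so the real square root is never truncated. -/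
theorem delta_sq {n : ℕ} (M : Matrix (Fin n) (Fin n) ℂ) :
    delta M ^ 2 = frobSq (M - (M.trace / n) • 1) := by
  have h := frobSq_nonneg (M - (M.trace / n) • 1)
  rw [frobSq_sub_scalar] at h ⊢
  rw [delta, frobenius_norm_sq, Real.sq_sqrt h]

theorem delta_nonneg {n : ℕ} (M : Matrix (Fin n) (Fin n) ℂ) : 0 ≤ delta M :=
  Real.sqrt_nonneg _

theorem sum_eq_trace_of_isSpectrum {n : ℕ} {M : Matrix (Fin n) (Fin n) ℂ} {e : Fin n → ℂ}
    (he : IsSpectrum M e) : ∑ i, e i = M.trace := by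
  rw [Matrix.trace_eq_sum_roots_charpoly, ← he]; rfl

/-- Spectral variation of a diagonal matrix, with the trace of the perturbation split off. -/
theorem exists_perm_sum_le_delta {n : ℕ} (d e : Fin n → ℂ) (M : Matrix (Fin n) (Fin n) ℂ)
    (he : IsSpectrum M e) : ∃ σ : Equiv.Perm (Fin n), ∑ i, ‖e (σ i) - d i‖ ^ 2 ≤
      ((n : ℝ) + 1 - maxBlocks M) * delta (M - Matrix.diagonal d) ^ 2
        + 1 / (n : ℝ) * ‖(M - Matrix.diagonal d).trace‖ ^ 2 := by
  set F := M - Matrix.diagonal d with hF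
  -- The differences `e (σ i) - d i` have mean `F.trace / n` for every `σ`. Shifting `d` by this
  -- mean lowers the sum of squares by exactly the trace term.
  obtain ⟨σ, hσ⟩ := exists_perm_sum_le_frobSq (fun i => d i + F.trace / n) e M he
  refine ⟨σ, ?_⟩
  have hMF : M - Matrix.diagonal (fun i => d i + F.trace / n) = F - (F.trace / n) • 1 := by
    rw [Matrix.smul_one_eq_diagonal, hF, sub_sub, Matrix.diagonal_add]
  rw [hMF, ← delta_sq] at hσ
  have hsum : ∑ i, (e (σ i) - d i) = F.trace := by
    rw [Finset.sum_sub_distrib, Equiv.sum_comp σ e, sum_eq_trace_of_isSpectrum he, hF,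
      Matrix.trace_sub, Matrix.trace_diagonal]
  have hv := sum_norm_sub_mean_sq fun i => e (σ i) - d i
  rw [hsum] at hv
  simp only [← sub_sub] at hσ
  linarith

/-! ### Jordan matrices and their diagonal scaling -/

/-- The positions of a block diagonal matrix as pairs (block, index in the block). -/
def blockEquiv {n p : ℕ} (k : Fin p → ℕ) (h : ∑ i, k i = n) : (Σ a, Fin (k a)) ≃ Fin n :=
  finSigmaFinEquiv.trans (finCongr h)

/-- The diagonal of the Jordan matrix with the given block sizes and eigenvalues. -/
noncomputable def jordanDiag {n p : ℕ} (k : Fin p → ℕ) (h : ∑ i, k i = n) (μ : Fin p → ℂ)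
    (x : Fin n) : ℂ :=
  μ ((blockEquiv k h).symm x).1

/-- The nilpotent part of the Jordan matrices with the given block sizes. -/
noncomputable def jordanNilpotent {n p : ℕ} (k : Fin p → ℕ) (h : ∑ i, k i = n) :
    Matrix (Fin n) (Fin n) ℂ :=
  diagBlocks k h fun i => jordanBlock (k i) 0

/-- The diagonal of `scaling k h ε`. -/
noncomputable def scalingDiag {n p : ℕ} (k : Fin p → ℕ) (h : ∑ i, k i = n) (ε : ℝ)
    (x : Fin n) : ℝ :=
  ε ^ (((blockEquiv k h).symm x).2 : ℕ)

section jordan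

variable {n p : ℕ} (k : Fin p → ℕ) (h : ∑ i, k i = n)

theorem diagBlocks_apply_blockEquiv (B : ∀ i : Fin p, Matrix (Fin (k i)) (Fin (k i)) ℂ)
    (x y : Σ a, Fin (k a)) :
    diagBlocks k h B (blockEquiv k h x) (blockEquiv k h y) = Matrix.blockDiagonal' B x y := by
  rw [diagBlocks, blockEquiv, Matrix.reindex_apply, Matrix.submatrix_apply,
    Equiv.symm_apply_apply, Equiv.symm_apply_apply]

theorem scaling_eq_diagonal (ε : ℝ) :
    scaling k h ε = Matrix.diagonal fun x => (scalingDiag k h ε x : ℂ) := by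
  rw [scaling, diagBlocks, Matrix.blockDiagonal'_diagonal, Matrix.reindex_apply,
    Matrix.submatrix_diagonal_equiv]
  congr 1
  funext x
  simp [scalingDiag, blockEquiv]

theorem scalingDiag_blockEquiv (ε : ℝ) (x : Σ a, Fin (k a)) :
    scalingDiag k h ε (blockEquiv k h x) = ε ^ (x.2 : ℕ) :=
  congrArg (fun z : Σ a, Fin (k a) => ε ^ (z.2 : ℕ)) ((blockEquiv k h).symm_apply_apply x)

theorem jordanBlock_eq (l : ℕ) (ν : ℂ) :
    jordanBlock l ν = Matrix.diagonal (fun _ => ν) + jordanBlock l 0 := by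
  ext i j
  by_cases hij : i = j <;> simp [jordanBlock, hij]

theorem diagBlocks_jordanBlock (μ : Fin p → ℂ) :
    (diagBlocks k h fun i => jordanBlock (k i) (μ i))
      = Matrix.diagonal (jordanDiag k h μ) + jordanNilpotent k h := by
  have h1 : (fun i => jordanBlock (k i) (μ i))
      = (fun i => Matrix.diagonal fun _ => μ i) + fun i => jordanBlock (k i) 0 :=
    funext fun i => jordanBlock_eq _ _
  rw [h1, diagBlocks, Matrix.blockDiagonal'_add, Matrix.blockDiagonal'_diagonal, jordanNilpotent,
    diagBlocks, Matrix.reindex_apply, Matrix.reindex_apply, Matrix.submatrix_add,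
    Pi.add_apply, Pi.add_apply, Matrix.submatrix_diagonal_equiv]
  rfl

/-- A nonzero entry joins consecutive indices of one block, where the scaling exponent grows by one.
Hence conjugation by the scaling matrix multiplies the nilpotent part by `ε`. -/
theorem jordanNilpotent_apply (x y : Fin n) :
    jordanNilpotent k h x y = 0 ∨ (jordanNilpotent k h x y = 1 ∧
      ∀ ε, scalingDiag k h ε y = scalingDiag k h ε x * ε) := by
  obtain ⟨⟨a, i⟩, rfl⟩ := (blockEquiv k h).surjective x
  obtain ⟨⟨b, j⟩, rfl⟩ := (blockEquiv k h).surjective y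
  rw [jordanNilpotent, diagBlocks_apply_blockEquiv]
  simp only [scalingDiag_blockEquiv]
  by_cases hab : a = b
  · subst hab
    rw [Matrix.blockDiagonal'_apply_eq]
    by_cases hij : i = j
    · exact Or.inl (by simp [jordanBlock, hij])
    · by_cases hij' : (i : ℕ) + 1 = j
      · exact Or.inr ⟨by simp [jordanBlock, hij, hij'], fun ε => by rw [← hij', pow_succ]⟩
      · exact Or.inl (by simp [jordanBlock, hij, hij'])
  · exact Or.inl (Matrix.blockDiagonal'_apply_ne _ _ _ hab)

theorem frobSq_jordanBlock_zero (l : ℕ) : frobSq (jordanBlock (l + 1) 0) = l := by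
  have h0 : ∀ i : Fin (l + 1), jordanBlock (l + 1) 0 i 0 = 0 := fun i => by
    simp [jordanBlock]
  have h1 : ∀ j : Fin l, ∑ i, ‖jordanBlock (l + 1) 0 i j.succ‖ ^ 2 = 1 := fun j => by
    rw [Finset.sum_eq_single j.castSucc]
    · simp [jordanBlock, Fin.ext_iff]
    · intro i _ hi
      have hne : (i : ℕ) ≠ j := fun he => hi (Fin.ext he)
      simp [jordanBlock, hne]
    · simp
  rw [frobSq, Finset.sum_comm, Fin.sum_univ_succ]
  simp [h0, h1]

/-- A block of order `l ≥ 1` carries `l - 1` ones; an empty block would break the count. -/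
theorem frobSq_jordanNilpotent (hk : ∀ i, 0 < k i) :
    frobSq (jordanNilpotent k h) = (n : ℝ) - p := by
  have h1 : frobSq (jordanNilpotent k h) = ∑ a, frobSq (jordanBlock (k a) 0) := by
    rw [frobSq, ← (blockEquiv k h).sum_comp, Fintype.sum_sigma]
    refine Finset.sum_congr rfl fun a _ => Finset.sum_congr rfl fun i _ => ?_
    rw [← (blockEquiv k h).sum_comp, Fintype.sum_sigma, Finset.sum_eq_single a]
    · simp only [jordanNilpotent, diagBlocks_apply_blockEquiv, Matrix.blockDiagonal'_apply_eq]
    · intro b _ hb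
      refine Finset.sum_eq_zero fun j _ => ?_
      rw [jordanNilpotent, diagBlocks_apply_blockEquiv,
        Matrix.blockDiagonal'_apply_ne _ _ _ hb.symm]
      simp
    · simp
  have h2 : ∀ a, frobSq (jordanBlock (k a) 0) = (k a : ℝ) - 1 := fun a => by
    obtain ⟨l, hl⟩ := Nat.exists_eq_add_of_lt (hk a)
    rw [hl, zero_add, frobSq_jordanBlock_zero]
    simp
  rw [h1, Finset.sum_congr rfl fun a _ => h2 a, Finset.sum_sub_distrib, ← Nat.cast_sum, h]
  simp

theorem trace_jordanNilpotent : (jordanNilpotent k h).trace = 0 := by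
  refine Finset.sum_eq_zero fun x _ => ?_
  obtain ⟨⟨a, i⟩, rfl⟩ := (blockEquiv k h).surjective x
  rw [Matrix.diag_apply, jordanNilpotent, diagBlocks_apply_blockEquiv,
    Matrix.blockDiagonal'_apply_eq]
  simp [jordanBlock]

/-- The exponents in the scaling range from `0` to at most `m - 1`; the worst ratio has the largest
one in the denominator. -/
theorem norm_scalingDiag_ratio_le {ε : ℝ} (hε : 0 < ε) (hε1 : ε ≤ 1) {m : ℕ}
    (hm : ∀ i, k i ≤ m) (x y : Fin n) :
    (scalingDiag k h ε x)⁻¹ * scalingDiag k h ε y ≤ (ε ^ (m - 1))⁻¹ := by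
  have h1 : scalingDiag k h ε y ≤ 1 := pow_le_one₀ hε.le hε1
  have h2 : ε ^ (m - 1) ≤ scalingDiag k h ε x := by
    refine pow_le_pow_of_le_one hε.le hε1 ?_
    have := ((blockEquiv k h).symm x).2.isLt
    have := hm ((blockEquiv k h).symm x).1
    omega
  calc _ ≤ (ε ^ (m - 1))⁻¹ * 1 := by
        gcongr
        exact pow_nonneg hε.le _
    _ = _ := mul_one _

/-- The eigenvalues of a matrix with a given Jordan form. -/
theorem exists_perm_eq_jordanDiag {A Q : Matrix (Fin n) (Fin n) ℂ} (hQ : IsUnit Q.det)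
    {μ : Fin p → ℂ} (hA : Q⁻¹ * A * Q = diagBlocks k h fun i => jordanBlock (k i) (μ i))
    {lam : Fin n → ℂ} (hlam : IsSpectrum A lam) :
    ∃ τ : Equiv.Perm (Fin n), lam = jordanDiag k h μ ∘ τ := by
  refine exists_perm_comp_eq_of_map_eq ?_
  rw [hlam, ← charpoly_conj_of_mul_eq_one (Matrix.mul_nonsing_inv Q hQ) A, hA,
    ← Matrix.charpoly_reindex (blockEquiv k h).symm, charpoly_of_partialOrder_triangular,
    ← roots_prod_X_sub_C_univ]
  · refine congrArg Polynomial.roots (Fintype.prod_equiv (blockEquiv k h) _ _ fun ⟨a, i⟩ => ?_)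
    rw [Matrix.reindex_apply, Matrix.submatrix_apply, Equiv.symm_symm,
      diagBlocks_apply_blockEquiv, Matrix.blockDiagonal'_apply_eq, jordanDiag,
      Equiv.symm_apply_apply]
    simp [jordanBlock]
  · rintro ⟨a, i⟩ ⟨b, j⟩ hxy
    rw [Matrix.reindex_apply, Matrix.submatrix_apply, Equiv.symm_symm,
      diagBlocks_apply_blockEquiv]
    by_cases hab : a = b
    · subst hab
      have hlt : j < i := not_le.1 fun hle => hxy (Sigma.mk_le_mk_iff.2 hle)
      have hne : ¬ (i : ℕ) + 1 = j := by
        have : (j : ℕ) < i := hlt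
        omega
      rw [Matrix.blockDiagonal'_apply_eq]
      simp [jordanBlock, hlt.ne', hne]
    · exact Matrix.blockDiagonal'_apply_ne _ _ _ hab

end jordan

/-! ### Perturbation of the scaled Jordan form -/

/-- Effect of a diagonal similarity on the Frobenius norm of a perturbation of a shift matrix. -/
theorem frobSq_scaled_add_le {ι : Type*} [Fintype ι] {N M : Matrix ι ι ℂ} {τ : ι → ι → ℝ}
    {ε K : ℝ} (hτ0 : ∀ x y, 0 ≤ τ x y) (hτ : ∀ x y, τ x y ≤ K)
    (hN : ∀ x y, N x y = 0 ∨ (N x y = 1 ∧ τ x y = ε)) :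
    frobSq (Matrix.of fun x y => (τ x y : ℂ) * (N x y + M x y)) ≤
      ε ^ 2 * frobSq N + 2 * ε ^ 2 * (√(frobSq N) * √(frobSq M)) + K ^ 2 * frobSq M := by
  -- Cross terms occur only on the support of `N`, where the factor is `ε`; they therefore carry `ε
  -- ^ 2` rather than `ε * K`.
  have hpt : ∀ x y, ‖(τ x y : ℂ) * (N x y + M x y)‖ ^ 2 ≤
      ε ^ 2 * ‖N x y‖ ^ 2 + 2 * ε ^ 2 * (‖N x y‖ * ‖M x y‖) + K ^ 2 * ‖M x y‖ ^ 2 := by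
    intro x y
    rw [norm_mul, Complex.norm_real, Real.norm_of_nonneg (hτ0 x y)]
    have hK : τ x y ^ 2 ≤ K ^ 2 := pow_le_pow_left₀ (hτ0 x y) (hτ x y) 2
    have hKM := mul_le_mul_of_nonneg_right hK (sq_nonneg ‖M x y‖)
    rcases hN x y with h0 | ⟨h1, hε⟩
    · rw [h0]
      simpa [mul_pow] using hKM
    · rw [h1]
      rw [hε] at hKM ⊢
      have h2 : ‖1 + M x y‖ ≤ 1 + ‖M x y‖ := by simpa using norm_add_le 1 (M x y)
      have h3 : ‖1 + M x y‖ ^ 2 ≤ (1 + ‖M x y‖) ^ 2 := pow_le_pow_left₀ (norm_nonneg _) h2 2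
      have h4 := mul_le_mul_of_nonneg_left h3 (sq_nonneg ε)
      rw [mul_pow, norm_one]
      linarith
  have hcs : ∑ x, ∑ y, ‖N x y‖ * ‖M x y‖ ≤ √(frobSq N) * √(frobSq M) := by
    have := Real.sum_mul_le_sqrt_mul_sqrt (Finset.univ : Finset (ι × ι))
      (fun z => ‖N z.1 z.2‖) (fun z => ‖M z.1 z.2‖)
    simpa only [Fintype.sum_prod_type, frobSq] using this
  calc _ ≤ ∑ x, ∑ y, (ε ^ 2 * ‖N x y‖ ^ 2 + 2 * ε ^ 2 * (‖N x y‖ * ‖M x y‖)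
        + K ^ 2 * ‖M x y‖ ^ 2) :=
        Finset.sum_le_sum fun x _ => Finset.sum_le_sum fun y _ => hpt x y
    _ = ε ^ 2 * frobSq N + 2 * ε ^ 2 * (∑ x, ∑ y, ‖N x y‖ * ‖M x y‖) + K ^ 2 * frobSq M := by
        simp only [Finset.sum_add_distrib, ← Finset.mul_sum, frobSq]
    _ ≤ _ := by gcongr

theorem maxBlocks_le {n : ℕ} (M : Matrix (Fin n) (Fin n) ℂ) : maxBlocks M ≤ n := by
  obtain ⟨U, -, k, h, B, hk, -⟩ := (isGreatest_maxBlocks M).1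
  calc maxBlocks M = ∑ _i : Fin (maxBlocks M), 1 := by simp
    _ ≤ ∑ i, k i := Finset.sum_le_sum fun i _ => hk i
    _ = n := h

/-- Spectral variation bound after a diagonal rescaling of the Jordan form. -/
theorem exists_perm_sum_le_of_scaling {n p : ℕ} {A E Q : Matrix (Fin n) (Fin n) ℂ}
    (k : Fin p → ℕ) (hk : ∀ i, 0 < k i) (h : ∑ i, k i = n) (μ : Fin p → ℂ)
    (hQ : IsUnit Q.det)
    (hJ : Q⁻¹ * A * Q = diagBlocks k h fun i => jordanBlock (k i) (μ i))
    {m : ℕ} (hm : ∀ i, k i ≤ m) {ε : ℝ} (hε : 0 < ε) (hε1 : ε ≤ 1)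
    {lam lam' : Fin n → ℂ} (hlam : IsSpectrum A lam) (hlam' : IsSpectrum (A + E) lam') :
    ∃ π : Equiv.Perm (Fin n), ∑ i, ‖lam' (π i) - lam i‖ ^ 2 ≤
      ((n : ℝ) + 1 - maxBlocks ((scaling k h ε)⁻¹ * Q⁻¹ * (A + E) * Q * scaling k h ε)) *
        (ε ^ 2 * ((n : ℝ) - p) + 2 * ε ^ 2 * (√((n : ℝ) - p) * delta (Q⁻¹ * E * Q))
          + ((ε ^ (m - 1))⁻¹) ^ 2 * delta (Q⁻¹ * E * Q) ^ 2)
        + 1 / (n : ℝ) * ‖E.trace‖ ^ 2 := by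
  set t := scalingDiag k h ε with ht
  have ht0 : ∀ x, 0 < t x := fun x => pow_pos hε _
  set T := scaling k h ε with hT
  have hTd : T = Matrix.diagonal fun x => (t x : ℂ) := scaling_eq_diagonal k h ε
  set T' : Matrix (Fin n) (Fin n) ℂ := Matrix.diagonal fun x => ((t x)⁻¹ : ℂ) with hT'
  have hTT' : T * T' = 1 := by
    rw [hTd, hT', Matrix.diagonal_mul_diagonal, ← Matrix.diagonal_one]
    congr 1
    funext x
    exact mul_inv_cancel₀ (Complex.ofReal_ne_zero.2 (ht0 x).ne')
  have hTinv : T⁻¹ = T' := Matrix.inv_eq_right_inv hTT'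
  set M := T⁻¹ * Q⁻¹ * (A + E) * Q * T with hM
  set D := Matrix.diagonal (jordanDiag k h μ) with hD
  set N := jordanNilpotent k h with hN
  set G := Q⁻¹ * E * Q with hG
  have hQQ : Q * Q⁻¹ = 1 := Matrix.mul_nonsing_inv Q hQ
  have hMspec : IsSpectrum M lam' := by
    have hinv : (Q * T) * (T⁻¹ * Q⁻¹) = 1 := by
      calc _ = Q * (T * T⁻¹) * Q⁻¹ := by simp only [Matrix.mul_assoc]
        _ = 1 := by rw [hTinv, hTT', Matrix.mul_one, hQQ]
    have := charpoly_conj_of_mul_eq_one hinv (A + E)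
    rw [← Matrix.mul_assoc, ← hM] at this
    rw [IsSpectrum, this]
    exact hlam'
  have hGtr : G.trace = E.trace := by
    rw [hG, Matrix.trace_mul_comm, ← Matrix.mul_assoc, hQQ, Matrix.one_mul]
  have hMe : ∀ x y, M x y = (t x : ℂ)⁻¹ * (D + N + G) x y * t y := fun x y => by
    have : M = T' * (D + N + G) * T := by
      rw [hM, hD, hN, ← diagBlocks_jordanBlock, ← hJ, hG, hTinv]
      simp only [Matrix.mul_add, Matrix.add_mul, Matrix.mul_assoc]
    rw [this, hTd, hT', Matrix.mul_diagonal, Matrix.diagonal_mul]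
  have hcancel : ∀ x, (t x : ℂ)⁻¹ * t x = 1 := fun x =>
    inv_mul_cancel₀ (Complex.ofReal_ne_zero.2 (ht0 x).ne')
  -- The diagonal matrix `D` commutes with `T`, so `M - D = T⁻¹ * (N + G) * T`.
  have hFe : ∀ x y, (M - D) x y = (((t x)⁻¹ * t y : ℝ) : ℂ) * (N x y + G x y) := fun x y => by
    rw [Matrix.sub_apply, hMe, Matrix.add_apply, Matrix.add_apply]
    by_cases hxy : x = y
    · subst hxy
      push_cast
      linear_combination D x x * hcancel x
    · rw [hD, Matrix.diagonal_apply_ne _ hxy]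
      push_cast
      ring
  have hFtr : (M - D).trace = E.trace := by
    have hNtr : N.trace = 0 := trace_jordanNilpotent k h
    rw [← hGtr, ← zero_add G.trace, ← hNtr, ← Matrix.trace_add]
    refine Finset.sum_congr rfl fun x _ => ?_
    rw [Matrix.diag_apply, Matrix.diag_apply, hFe, Matrix.add_apply, Complex.ofReal_mul,
      Complex.ofReal_inv, hcancel, one_mul]
  set G' := G - (G.trace / n) • (1 : Matrix (Fin n) (Fin n) ℂ) with hG'
  -- Scalar matrices commute with `T`, so the trace part can be removed from `G` before the scaling;
  -- this makes `delta` of the unscaled `G` appear.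
  have hF' : M - D - ((M - D).trace / n) • 1
      = Matrix.of fun x y => (((t x)⁻¹ * t y : ℝ) : ℂ) * (N x y + G' x y) := by
    ext x y
    rw [hFtr, Matrix.sub_apply, hFe, Matrix.of_apply, hG', Matrix.sub_apply, hGtr]
    by_cases hxy : x = y
    · subst hxy
      simp only [Matrix.smul_apply, Matrix.one_apply_eq, smul_eq_mul]
      push_cast
      linear_combination (E.trace / n) * hcancel x
    · simp [Matrix.one_apply_ne hxy]
  have hbound := frobSq_scaled_add_le (N := N) (M := G') (τ := fun x y => (t x)⁻¹ * t y)
    (ε := ε) (K := (ε ^ (m - 1))⁻¹)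
    (fun x y => mul_nonneg (inv_nonneg.2 (ht0 x).le) (ht0 y).le)
    (norm_scalingDiag_ratio_le k h hε hε1 hm) (fun x y => by
      refine (jordanNilpotent_apply k h x y).imp_right fun ⟨h1, h2⟩ => ⟨h1, ?_⟩
      have h3 : t y = t x * ε := h2 ε
      have := (ht0 x).ne'
      simp only [h3]
      field_simp)
  rw [← hF', ← delta_sq, ← delta_sq, hN, frobSq_jordanNilpotent k h hk,
    Real.sqrt_sq (delta_nonneg G)] at hbound
  obtain ⟨σ, hσ⟩ := exists_perm_sum_le_delta (jordanDiag k h μ) lam' M hMspec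
  obtain ⟨τ, rfl⟩ := exists_perm_eq_jordanDiag k h hQ hJ hlam
  refine ⟨τ.trans σ, ?_⟩
  rw [hFtr] at hσ
  have hs : (0 : ℝ) ≤ (n : ℝ) + 1 - maxBlocks M := by
    have : (maxBlocks M : ℝ) ≤ n := by exact_mod_cast maxBlocks_le M
    linarith
  calc _ = ∑ i, ‖lam' (σ i) - jordanDiag k h μ i‖ ^ 2 :=
        Equiv.sum_comp τ fun i => ‖lam' (σ i) - jordanDiag k h μ i‖ ^ 2
    _ ≤ _ := hσ
    _ ≤ _ := by gcongr

/-- If the perturbation is a scalar matrix, the eigenvalues are all shifted by this scalar. -/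
theorem exists_perm_sum_eq_of_delta_eq_zero {n p : ℕ} {A E Q : Matrix (Fin n) (Fin n) ℂ}
    (k : Fin p → ℕ) (h : ∑ i, k i = n) (μ : Fin p → ℂ) (hQ : IsUnit Q.det)
    (hJ : Q⁻¹ * A * Q = diagBlocks k h fun i => jordanBlock (k i) (μ i))
    (hδ : delta (Q⁻¹ * E * Q) = 0)
    {lam lam' : Fin n → ℂ} (hlam : IsSpectrum A lam) (hlam' : IsSpectrum (A + E) lam') :
    ∃ π : Equiv.Perm (Fin n),
      ∑ i, ‖lam' (π i) - lam i‖ ^ 2 = 1 / (n : ℝ) * ‖E.trace‖ ^ 2 := by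
  have hQQ : Q * Q⁻¹ = 1 := Matrix.mul_nonsing_inv Q hQ
  have htr : (Q⁻¹ * E * Q).trace = E.trace := by
    rw [Matrix.trace_mul_comm, ← Matrix.mul_assoc, hQQ, Matrix.one_mul]
  set c := E.trace / n with hc
  -- Zero distance to the trace part forces a scalar matrix, so `A + E` has the same Jordan
  -- structure with every eigenvalue moved by `c`.
  have hG : Q⁻¹ * E * Q = c • 1 := by
    have h0 := delta_sq (Q⁻¹ * E * Q)
    rw [hδ, htr, ← hc, zero_pow two_ne_zero, frobSq, eq_comm, Finset.sum_eq_zero_iff_of_nonneg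
      fun i _ => Finset.sum_nonneg fun j _ => sq_nonneg _] at h0
    refine sub_eq_zero.1 (Matrix.ext fun i j => ?_)
    have h1 := h0 i (Finset.mem_univ _)
    rw [Finset.sum_eq_zero_iff_of_nonneg fun j _ => sq_nonneg _] at h1
    simpa using h1 j (Finset.mem_univ _)
  have hJ' : Q⁻¹ * (A + E) * Q = diagBlocks k h fun i => jordanBlock (k i) (μ i + c) := by
    rw [Matrix.mul_add, Matrix.add_mul, hJ, hG, diagBlocks_jordanBlock,
      diagBlocks_jordanBlock k h fun i => μ i + c, Matrix.smul_one_eq_diagonal, add_right_comm,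
      Matrix.diagonal_add]
    rfl
  obtain ⟨τ, rfl⟩ := exists_perm_eq_jordanDiag k h hQ hJ hlam
  obtain ⟨τ', rfl⟩ := exists_perm_eq_jordanDiag k h hQ hJ' hlam'
  refine ⟨τ.trans τ'.symm, ?_⟩
  simp only [jordanDiag, Function.comp_apply, Equiv.trans_apply, Equiv.apply_symm_apply,
    add_sub_cancel_left, Finset.sum_const, Finset.card_univ, Fintype.card_fin, nsmul_eq_mul, hc,
    norm_div, Complex.norm_natCast]
  rcases Nat.eq_zero_or_pos n with rfl | hn
  · simp
  · field_simp

end SpecVar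

/-! ### The theorem: choice of the scaling parameter -/

theorem theorem3p5 {n p : ℕ} (A E Q : Matrix (Fin n) (Fin n) ℂ)
    (k : Fin p → ℕ) (hk : ∀ i, 0 < k i) (hsum : ∑ i, k i = n) (μ : Fin p → ℂ)
    (hQ : IsUnit Q.det)
    (hJordan : Q⁻¹ * A * Q = SpecVar.diagBlocks k hsum fun i => SpecVar.jordanBlock (k i) (μ i))
    (m : ℕ) (hm : m = Finset.univ.sup k)
    (δ : ℝ) (hδ : δ = SpecVar.delta (Q⁻¹ * E * Q))
    (T : Matrix (Fin n) (Fin n) ℂ) (hT : T = SpecVar.scaling k hsum (δ ^ (1 / (m : ℝ))))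
    (s₂ s₃ : ℝ)
    (hs₂ : s₂ = (n : ℝ) + 1 - (SpecVar.maxBlocks (Q⁻¹ * (A + E) * Q) : ℝ))
    (hs₃ : s₃ = (n : ℝ) + 1 - (SpecVar.maxBlocks (T⁻¹ * Q⁻¹ * (A + E) * Q * T) : ℝ))
    (lam lam' : Fin n → ℂ)
    (hlam : SpecVar.IsSpectrum A lam) (hlam' : SpecVar.IsSpectrum (A + E) lam') :
    ∃ π : Equiv.Perm (Fin n),
      (δ < 1 → SpecVar.dTwo lam lam' π ≤
        √(s₃ * ((n : ℝ) - p + 2 * √((n : ℝ) - p) * δ + 1) * δ ^ (2 / (m : ℝ))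
          + 1 / (n : ℝ) * ‖E.trace‖ ^ 2)) ∧
      (1 ≤ δ → SpecVar.dTwo lam lam' π ≤
        √(s₂ * (√((n : ℝ) - p) + δ) ^ 2 + 1 / (n : ℝ) * ‖E.trace‖ ^ 2)) := by
  have hkm : ∀ i, k i ≤ m := fun i => hm ▸ Finset.le_sup (Finset.mem_univ i)
  have hδ0 : 0 ≤ δ := hδ ▸ SpecVar.delta_nonneg _
  rcases le_or_gt 1 δ with h1 | h1
  -- With `ε = 1` there is no scaling and the bound is a perfect square.
  · obtain ⟨π, hπ⟩ := SpecVar.exists_perm_sum_le_of_scaling k hk hsum μ hQ hJordan hkm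
      one_pos le_rfl hlam hlam'
    have hT1 : SpecVar.scaling k hsum 1 = 1 := by
      rw [SpecVar.scaling_eq_diagonal]
      simp [SpecVar.scalingDiag]
    rw [hT1, inv_one, Matrix.one_mul, Matrix.mul_one, ← hs₂, ← hδ] at hπ
    refine ⟨π, fun h => absurd h1 (not_le.2 h), fun _ => Real.sqrt_le_sqrt (hπ.trans_eq ?_)⟩
    have hnp : 0 ≤ (n : ℝ) - p := by
      rw [← SpecVar.frobSq_jordanNilpotent k hsum hk]
      exact SpecVar.frobSq_nonneg _
    rw [add_sq, Real.sq_sqrt hnp]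
    simp only [one_pow, inv_one]
    ring
  · rcases hδ0.eq_or_lt with h0 | h0
    · obtain ⟨π, hπ⟩ := SpecVar.exists_perm_sum_eq_of_delta_eq_zero k hsum μ hQ hJordan
        (hδ.symm.trans h0.symm) hlam hlam'
      refine ⟨π, fun _ => Real.sqrt_le_sqrt (hπ.trans_le ?_), fun h => absurd h (not_le.2 h1)⟩
      -- For `m = 0` the exponent `2 / m` is `0` and `0 ^ 0 = 1`, so the `s₃` term does not vanish;
      -- `0 ≤ s₃` suffices there.
      rcases Nat.eq_zero_or_pos m with hm0 | hm0
      · have hn : n = 0 := by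
          rw [← hsum]
          exact Finset.sum_eq_zero fun i _ => Nat.le_zero.1 (hm0 ▸ hkm i)
        subst hn
        have hp : p = 0 := by
          by_contra hp
          have := hkm ⟨0, Nat.pos_of_ne_zero hp⟩
          have := hk ⟨0, Nat.pos_of_ne_zero hp⟩
          omega
        subst hp
        have : 0 ≤ s₃ := by
          have h2 := SpecVar.maxBlocks_le (T⁻¹ * Q⁻¹ * (A + E) * Q * T)
          rw [hs₃, Nat.le_zero.1 h2]
          simp
        simp [← h0, hm0, this]
      · have : (2 : ℝ) / m ≠ 0 := by positivity
        rw [← h0, Real.zero_rpow this, mul_zero, zero_add]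
    · have hm0 : m ≠ 0 := fun hm0 => by
        have hn : n = 0 := by
          rw [← hsum]
          exact Finset.sum_eq_zero fun i _ => Nat.le_zero.1 (hm0 ▸ hkm i)
        subst hn
        have h2 := SpecVar.delta_sq (Q⁻¹ * E * Q)
        rw [← hδ] at h2
        exact h0.ne' (by simpa [SpecVar.frobSq] using h2)
      set ε := δ ^ (1 / (m : ℝ)) with hε
      have hε0 : 0 < ε := Real.rpow_pos_of_pos h0 _
      have hεm : ε ^ m = δ := by
        rw [hε, one_div, Real.rpow_inv_natCast_pow hδ0 hm0]
      have hε2 : δ ^ (2 / (m : ℝ)) = ε ^ 2 := by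
        rw [hε, ← Real.rpow_natCast, ← Real.rpow_mul hδ0]
        congr 1
        push_cast
        ring
      -- The largest magnification turns `δ = ε ^ m` into `ε`, so all three terms of the bound share
      -- the factor `ε ^ 2`.
      have hKδ : (ε ^ (m - 1))⁻¹ * δ = ε := by
        rw [← hεm, ← pow_sub_one_mul hm0 ε]
        exact inv_mul_cancel_left₀ (pow_ne_zero _ hε0.ne') _
      obtain ⟨π, hπ⟩ := SpecVar.exists_perm_sum_le_of_scaling k hk hsum μ hQ hJordan hkm
        hε0 (Real.rpow_le_one hδ0 h1.le (by positivity)) hlam hlam'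
      rw [← hT, ← hs₃, ← hδ, ← mul_pow, hKδ] at hπ
      refine ⟨π, fun _ => Real.sqrt_le_sqrt (hπ.trans_eq ?_), fun h => absurd h (not_le.2 h1)⟩
      rw [hε2]
      ring
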